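/- Let $N\simeq\mathbb{Z}^n$ be a lattice, $N_{\mathbb{R}}=N\otimes\mathbb{R}$ and $M_{\mathbb{R}}=N_{\mathbb{R}}^{\vee}$. A polyhedron is an intersection of finitely many closed halfspaces $\{u : \langle x,u\rangle\ge b\}$, with $x\in M_{\mathbb{R}}$ and $b\in\mathbb{R}$; it is rational if these halfspaces can be chosen with rational coefficients with respect to the lattice (that is, $x$ takes rational values on $N$ and $b\in\mathbb{Q}$), and strongly convex if it contains no line. A face of a polyhedron $\Lambda$ is a non-empty subset of the form $\Lambda_x=\{u\in\Lambda : \langle x,u\rangle\le\langle x,v\rangle\ \forall v\in\Lambda\}$ with $x\in M_{\mathbb{R}}$. A polyhedral complex is a non-empty finite collection $\Pi$ of non-empty polyhedra such that every face of an element of $\Pi$ is in $\Pi$ and any two elements of $\Pi$ are either disjoint or intersect in a common face. It is rational (respectively strongly convex, conic) if all its elements are rational (respectively strongly convex, convex cones generated by finitely many vectors); a fan is a strongly convex conic polyhedral complex. The support of $\Pi$ is $|\Pi|=\bigcup_{\Lambda\in\Pi}\Lambda$. For $E\subset N_{\mathbb{R}}$ put $$\operatorname{rec}(E)=\bigcap_{p\in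 E}\{u\in N_{\mathbb{R}} : p+\lambda u\in E\ \ \forall\lambda\ge 0\},\qquad \operatorname{c}(E)=\overline{\mathbb{R}_{>0}(E\times\{1\})}\subset N_{\mathbb{R}}\times\mathbb{R},$$ and for a polyhedral complex $\Pi$ in $N_{\mathbb{R}}$ put $$\operatorname{rec}(\Pi)=\{\operatorname{rec}(\Lambda) : \Lambda\in\Pi\},\qquad \operatorname{c}(\Pi)=\{\operatorname{c}(\Lambda) : \Lambda\in\Pi\}\cup\{\sigma\times\{0\} : \sigma\in\operatorname{rec}(\Pi)\}.$$ Let $\Pi$ be a polyhedral complex in $N_{\mathbb{R}}$ whose support $|\Pi|$ is convex. Then $\operatorname{rec}(\Pi)$ and $\operatorname{c}(\Pi)$ are conic polyhedral complexes, in $N_{\mathbb{R}}$ and in $N_{\mathbb{R}}\times\mathbb{R}$ respectively. If, in addition, $\Pi$ is rational, then $\operatorname{rec}(\Pi)$ is rational (with respect to $N$) and $\operatorname{c}(\Pi)$ is rational (with respect to $N\oplus\mathbb{Z}$). If, in addition, $\Pi$ is strongly convex, then $\operatorname{rec}(\Pi)$ and $\operatorname{c}(\Pi)$ are fans. -/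

import Mathlib

namespace PolyComplex

section Basic

variable {V : Type*} [AddCommGroup V] [Module ℝ V]

/-- The intersection of the finitely many closed halfspaces `⟨x, u⟩ ≥ b`, for `(x, b)` in `H`.
(The pairs with `x = 0` only add the trivial conditions `u ∈ V` and `u ∈ ∅`.) -/
def halfspaceInter (H : Finset (Module.Dual ℝ V × ℝ)) : Set V :=
  {u | ∀ h ∈ H, h.2 ≤ h.1 u}

/-- A polyhedron: an intersection of finitely many closed halfspaces. -/
def IsPolyhedron (E : Set V) : Prop :=
  ∃ H : Finset (Module.Dual ℝ V × ℝ), E = halfspaceInter H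

/-- A polyhedron is rational, with respect to the lattice `L`, if the halfspaces can be chosen
with rational coefficients: each linear form takes rational values on `L` (that is, it has rational
coordinates in the dual of a basis of `L`) and each constant term is rational. -/
def IsRationalPolyhedron (L : Submodule ℤ V) (E : Set V) : Prop :=
  ∃ H : Finset (Module.Dual ℝ V × ℝ),
    (∀ h ∈ H, (∀ l ∈ L, ∃ q : ℚ, h.1 l = (q : ℝ)) ∧ ∃ q : ℚ, h.2 = (q : ℝ)) ∧
      E = halfspaceInter H

/-- A set containing no (affine) line. -/
def ContainsNoLine (E : Set V) : Prop :=
  ¬ ∃ p v : V, v ≠ 0 ∧ ∀ t : ℝ, p + t • v ∈ E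

/-- A convex polyhedral cone: the convex cone generated by a finite set of vectors. -/
def IsPolyhedralCone (E : Set V) : Prop :=
  ∃ S : Finset V, E = (PointedCone.hull ℝ (S : Set V) : Set V)

/-- The set `Λ_x` of the points of `Λ` at which the linear form `x` is minimal on `Λ`. -/
def minSet (Λ : Set V) (x : Module.Dual ℝ V) : Set V :=
  {u ∈ Λ | ∀ v ∈ Λ, x u ≤ x v}

/-- `F` is a face of `Λ`: a non-empty subset of the form `Λ_x`. -/
def IsFace (F Λ : Set V) : Prop :=
  F.Nonempty ∧ ∃ x : Module.Dual ℝ V, F = minSet Λ x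

/-- A polyhedral complex: a non-empty finite collection of non-empty polyhedra, which contains all
the faces of its elements, and any two elements of which are disjoint or meet in a common face. -/
structure IsPolyhedralComplex (P : Set (Set V)) : Prop where
  nonempty : P.Nonempty
  finite : P.Finite
  isPolyhedron : ∀ Λ ∈ P, IsPolyhedron Λ
  nonempty_of_mem : ∀ Λ ∈ P, Λ.Nonempty
  face_mem : ∀ Λ ∈ P, ∀ F, IsFace F Λ → F ∈ P
  inter : ∀ Λ₁ ∈ P, ∀ Λ₂ ∈ P,
    Disjoint Λ₁ Λ₂ ∨ (IsFace (Λ₁ ∩ Λ₂) Λ₁ ∧ IsFace (Λ₁ ∩ Λ₂) Λ₂)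

/-- A collection of polyhedra is rational if all its elements are. -/
def IsRational (L : Submodule ℤ V) (P : Set (Set V)) : Prop :=
  ∀ Λ ∈ P, IsRationalPolyhedron L Λ

/-- A collection of polyhedra is strongly convex if none of its elements contains a line. -/
def IsStronglyConvex (P : Set (Set V)) : Prop :=
  ∀ Λ ∈ P, ContainsNoLine Λ

/-- A conic polyhedral complex: a polyhedral complex all of whose elements are cones. -/
def IsConicComplex (P : Set (Set V)) : Prop :=
  IsPolyhedralComplex P ∧ ∀ σ ∈ P, IsPolyhedralCone σ

/-- A fan: a strongly convex conic polyhedral complex. -/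
def IsFan (P : Set (Set V)) : Prop :=
  IsConicComplex P ∧ IsStronglyConvex P

/-- The support `|P|` of a collection of sets. -/
def support (P : Set (Set V)) : Set V := ⋃ Λ ∈ P, Λ

/-- The local recession cone of `E` at `p`. -/
def localRec (E : Set V) (p : V) : Set V :=
  {u | ∀ t : ℝ, 0 ≤ t → p + t • u ∈ E}

/-- The recession cone of `E`: the intersection of its local recession cones. -/
def recCone (E : Set V) : Set V := ⋂ p ∈ E, localRec E p

/-- The recession of a polyhedral complex: the collection of the recession cones of its elements. -/
def recComplex (P : Set (Set V)) : Set (Set V) := {σ | ∃ Λ ∈ P, σ = recCone Λ}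

/-- The lattice `L × ℤ` of `V × ℝ`, for a lattice `L` of `V`. -/
def latticeProdInt (L : Submodule ℤ V) : Submodule ℤ (V × ℝ) :=
  L.prod (Submodule.span ℤ {(1 : ℝ)})

end Basic

section Cone

variable {V : Type*} [AddCommGroup V] [Module ℝ V] [TopologicalSpace V]

/-- The cone of `E`: the closure in `V × ℝ` of `ℝ_{>0} (E × {1})`. -/
def coneOf (E : Set V) : Set (V × ℝ) :=
  closure {w | ∃ t : ℝ, 0 < t ∧ ∃ u ∈ E, w = t • (u, (1 : ℝ))}

/-- The cone of a polyhedral complex: the collection of the cones of its elements, together with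
the sets `σ × {0}`, for `σ` in its recession. -/
def coneComplex (P : Set (Set V)) : Set (Set (V × ℝ)) :=
  {τ | ∃ Λ ∈ P, τ = coneOf Λ} ∪ {τ | ∃ σ ∈ recComplex P, τ = σ ×ˢ {(0 : ℝ)}}

end Cone

end PolyComplex

/-! Recession cones and cones of non-empty polyhedra are cut out by finitely many linear forms, and
their faces come from faces of the polyhedra: a form that is nonnegative on `rec(Λ)` attains its
minimum on `Λ` (`minSet_nonempty`). What can fail for a general complex is that two of these cones
meet in a common face.

An extreme subcone of such a cone is a face (`isFace_of_extreme`), so it is enough that `a, b ∈ σ`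
and `a + b ∈ τ` imply `a ∈ τ`. For recession cones of two polyhedra with a common point this follows
from their meeting in a face. In general, join a point of `Λ` to a point of `Λ'`. By convexity of
the support, the rays in direction `v + w` issued from the segment stay in the support, so each
eventually lies in one member. The parameters for which this member contains `v` and `w` in its
recession cone, and those for which it does not, form two closed sets covering `[0,1]`. By
connectedness they meet, which yields two members with a common point that contradict the first case
(`recCone_extreme`).

For `c(Π)`, a sum at positive height is rescaled to height one and handled by the complex itself; at
height zero everything reduces to recession cones.

Rationality and the absence of lines are read off from the explicit forms. -/

namespace PolyComplex

/-! ### Cones cut out by linear forms, and their faces -/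

section DualSet

variable {V : Type*} [AddCommGroup V] [Module ℝ V]

/-- The cone on which finitely many linear forms are nonnegative. -/
def dualSet (X : Finset (Module.Dual ℝ V)) : Set V := {u | ∀ x ∈ X, 0 ≤ x u}

lemma zero_mem_dualSet (X : Finset (Module.Dual ℝ V)) : (0 : V) ∈ dualSet X :=
  fun x _ => by simp

lemma add_mem_dualSet {X : Finset (Module.Dual ℝ V)} {u v : V} (hu : u ∈ dualSet X)
    (hv : v ∈ dualSet X) : u + v ∈ dualSet X := fun x hx => by
  rw [map_add]; exact add_nonneg (hu x hx) (hv x hx)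

lemma smul_mem_dualSet {X : Finset (Module.Dual ℝ V)} {u : V} {t : ℝ} (ht : 0 ≤ t)
    (hu : u ∈ dualSet X) : t • u ∈ dualSet X := fun x hx => by
  rw [map_smul]; exact mul_nonneg ht (hu x hx)

lemma dualSet_eq_halfspaceInter [DecidableEq (Module.Dual ℝ V × ℝ)]
    (X : Finset (Module.Dual ℝ V)) :
    dualSet X = halfspaceInter (X.image fun x => (x, (0 : ℝ))) := by
  ext u; simp [dualSet, halfspaceInter]

lemma isPolyhedron_dualSet (X : Finset (Module.Dual ℝ V)) : IsPolyhedron (dualSet X) := by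
  classical exact ⟨_, dualSet_eq_halfspaceInter X⟩

lemma isRationalPolyhedron_dualSet (L : Submodule ℤ V) (X : Finset (Module.Dual ℝ V))
    (hX : ∀ x ∈ X, ∀ l ∈ L, ∃ q : ℚ, x l = q) : IsRationalPolyhedron L (dualSet X) := by
  classical
  refine ⟨_, fun h hh => ?_, dualSet_eq_halfspaceInter X⟩
  obtain ⟨x, hx, rfl⟩ := Finset.mem_image.1 hh
  exact ⟨hX x hx, 0, by simp⟩

lemma eq_zero_of_line_nonneg {a b : ℝ} (h : ∀ t : ℝ, 0 ≤ a + t * b) : b = 0 := by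
  by_contra hb
  have := h (-(a + 1) / b)
  rw [div_mul_cancel₀ _ hb] at this
  linarith

lemma eq_zero_of_line_subset_dualSet {X : Finset (Module.Dual ℝ V)} {p v : V}
    (h : ∀ t : ℝ, p + t • v ∈ dualSet X) : ∀ x ∈ X, x v = 0 := fun x hx =>
  eq_zero_of_line_nonneg (a := x p) fun t => by simpa using h t x hx

/-- A face of a cone is the zero locus of a form that is nonnegative on the cone. -/
lemma nonneg_and_minSet_eq_of_nonempty {X : Finset (Module.Dual ℝ V)} {y : Module.Dual ℝ V}
    (hF : (minSet (dualSet X) y).Nonempty) :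
    (∀ u ∈ dualSet X, 0 ≤ y u) ∧ minSet (dualSet X) y = {u | u ∈ dualSet X ∧ y u = 0} := by
  obtain ⟨u₀, hu₀, hmin⟩ := hF
  have h0 := hmin 0 (zero_mem_dualSet X)
  have h2 := hmin (u₀ + u₀) (add_mem_dualSet hu₀ hu₀)
  rw [map_zero] at h0
  rw [map_add] at h2
  have hn : ∀ u ∈ dualSet X, 0 ≤ y u := fun u hu => by linarith [hmin u hu]
  refine ⟨hn, ?_⟩
  ext u
  constructor
  · rintro ⟨hu, hum⟩
    have := hum 0 (zero_mem_dualSet X)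
    rw [map_zero] at this
    exact ⟨hu, le_antisymm this (hn u hu)⟩
  · rintro ⟨hu, h⟩
    exact ⟨hu, fun v hv => h ▸ hn v hv⟩

/-- An extreme subcone of a cone cut out by finitely many forms is a face. -/
lemma isFace_of_extreme {X : Finset (Module.Dual ℝ V)} {τ : Set V} (hτ : τ ⊆ dualSet X)
    (h0 : (0 : V) ∈ τ) (hadd : ∀ a ∈ τ, ∀ b ∈ τ, a + b ∈ τ)
    (hsmul : ∀ t : ℝ, 0 < t → ∀ a ∈ τ, t • a ∈ τ)
    (hext : ∀ a ∈ dualSet X, ∀ b ∈ dualSet X, a + b ∈ τ → a ∈ τ) : IsFace τ (dualSet X) := by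
  classical
  -- A relative interior point of `τ`: summing one witness for each form that is not identically
  -- zero on `τ` makes all these forms positive at once.
  have hu : ∀ Y ⊆ X, ∃ u ∈ τ, ∀ x ∈ Y, (∀ a ∈ τ, x a = 0) ∨ 0 < x u := by
    intro Y
    induction Y using Finset.induction_on with
    | empty => exact fun _ => ⟨0, h0, by simp⟩
    | insert x Y _ ih =>
      intro hY
      obtain ⟨u, huτ, hu⟩ := ih ((Finset.subset_insert _ _).trans hY)
      by_cases hx : ∀ a ∈ τ, x a = 0
      · refine ⟨u, huτ, fun z hz => ?_⟩
        rcases Finset.mem_insert.1 hz with rfl | hz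
        exacts [Or.inl hx, hu z hz]
      · push Not at hx
        obtain ⟨a, ha, hxa⟩ := hx
        have hpos : 0 < x a :=
          lt_of_le_of_ne (hτ ha x (hY (Finset.mem_insert_self _ _))) hxa.symm
        refine ⟨u + a, hadd _ huτ _ ha, fun z hz => ?_⟩
        rw [map_add]
        rcases Finset.mem_insert.1 hz with rfl | hz
        · exact Or.inr (by linarith [hτ huτ z (hY (Finset.mem_insert_self _ _))])
        · rcases hu z hz with h | h
          · exact Or.inl h
          · exact Or.inr (by linarith [hτ ha z (hY (Finset.mem_insert_of_mem hz))])
  obtain ⟨u, huτ, hu⟩ := hu X subset_rfl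
  -- The supporting form is the sum of the forms of `X` that vanish on `τ`.
  let Z := X.filter fun x => ∀ a ∈ τ, x a = 0
  refine ⟨⟨0, h0⟩, ∑ x ∈ Z, x, ?_⟩
  have hnn : ∀ v ∈ dualSet X, ∀ x ∈ Z, 0 ≤ x v := fun v hv x hx =>
    hv x (Finset.mem_filter.1 hx).1
  have hzero : ∀ a ∈ τ, (∑ x ∈ Z, x) a = 0 := fun a ha => by
    rw [LinearMap.sum_apply]
    exact Finset.sum_eq_zero fun x hx => (Finset.mem_filter.1 hx).2 a ha
  ext v
  constructor
  · refine fun hv => ⟨hτ hv, fun w hw => ?_⟩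
    rw [hzero v hv, LinearMap.sum_apply]
    exact Finset.sum_nonneg (hnn w hw)
  · rintro ⟨hv, hmin⟩
    have hle := hmin 0 (zero_mem_dualSet X)
    rw [map_zero, LinearMap.sum_apply] at hle
    have hz := (Finset.sum_eq_zero_iff_of_nonneg (hnn v hv)).1
      (le_antisymm hle (Finset.sum_nonneg (hnn v hv)))
    -- A small multiple of `v` can be subtracted from `u` inside the cone: forms in `Z` vanish at
    -- both points and the others are positive at `u`. Extremality applied to `u = ε • v + (u - ε •
    -- v)` then puts `v` in `τ`.
    have hε : ∀ Y ⊆ X, ∃ ε : ℝ, 0 < ε ∧ ∀ x ∈ Y, ε * x v ≤ x u := by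
      intro Y
      induction Y using Finset.induction_on with
      | empty => exact fun _ => ⟨1, one_pos, by simp⟩
      | insert x Y _ ih =>
        intro hY
        obtain ⟨ε, hε, h⟩ := ih ((Finset.subset_insert _ _).trans hY)
        have hxX := hY (Finset.mem_insert_self _ _)
        obtain ⟨δ, hδ, hδx⟩ : ∃ δ : ℝ, 0 < δ ∧ δ * x v ≤ x u := by
          rcases hu x hxX with h | h
          · refine ⟨1, one_pos, ?_⟩
            rw [hz x (Finset.mem_filter.2 ⟨hxX, h⟩), h u huτ, mul_zero]
          · have h1 : 0 < 1 + x v := by linarith [hv x hxX]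
            refine ⟨x u / (1 + x v), div_pos h h1, ?_⟩
            rw [div_mul_eq_mul_div, div_le_iff₀ h1]
            nlinarith
        refine ⟨min ε δ, lt_min hε hδ, fun z hz => ?_⟩
        have hzv := hv z (hY hz)
        rcases Finset.mem_insert.1 hz with rfl | hz
        · exact (mul_le_mul_of_nonneg_right (min_le_right _ _) hzv).trans hδx
        · exact (mul_le_mul_of_nonneg_right (min_le_left _ _) hzv).trans (h z hz)
    obtain ⟨ε, hε, hεx⟩ := hε X subset_rfl
    have hsub : u - ε • v ∈ dualSet X := fun x hx => by
      simpa using hεx x hx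
    have := hext (ε • v) (smul_mem_dualSet hε.le hv) _ hsub (by simpa using huτ)
    simpa [smul_smul, inv_mul_cancel₀ hε.ne'] using hsmul ε⁻¹ (inv_pos.2 hε) _ this

end DualSet

/-! ### Finite generation, and the criterion for conic complexes -/

section MinkowskiWeyl

variable {V : Type*} [AddCommGroup V] [Module ℝ V]

/-- One step of the double description method: the intersection of a finitely generated cone with a
halfspace is finitely generated. -/
lemma exists_finset_hull_inter_halfspace (S : Finset V) (x : Module.Dual ℝ V) :
    ∃ T : Finset V, ∀ v, v ∈ PointedCone.hull ℝ (T : Set V) ↔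
      v ∈ PointedCone.hull ℝ (S : Set V) ∧ 0 ≤ x v := by
  classical
  let A := S.filter fun s => 0 ≤ x s
  let B := S.filter fun s => x s < 0
  -- Each pair of generators on opposite sides of the hyperplane `x = 0` contributes its positive
  -- combination lying on this hyperplane.
  let T := A ∪ (A ×ˢ B).image fun g => x g.1 • g.2 + (-x g.2) • g.1
  have hAS : (A : Set V) ⊆ S := Finset.coe_subset.2 (Finset.filter_subset _ _)
  have hBS : (B : Set V) ⊆ S := Finset.coe_subset.2 (Finset.filter_subset _ _)
  have hAx : ∀ a ∈ PointedCone.hull ℝ (A : Set V), 0 ≤ x a := by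
    intro a ha
    induction ha using Submodule.span_induction with
    | mem a ha => exact (Finset.mem_filter.1 ha).2
    | zero => simp
    | add a b _ _ iha ihb => rw [map_add]; exact add_nonneg iha ihb
    | smul t a _ ih =>
      change 0 ≤ x ((t : ℝ) • a)
      rw [map_smul]; exact mul_nonneg t.2 ih
  have hBx : ∀ b ∈ PointedCone.hull ℝ (B : Set V), b = 0 ∨ x b < 0 := by
    intro b hb
    induction hb using Submodule.span_induction with
    | mem b hb => exact Or.inr (Finset.mem_filter.1 hb).2
    | zero => exact Or.inl rfl
    | add a b _ _ iha ihb =>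
      rcases iha with rfl | ha
      · simpa using ihb
      · rcases ihb with rfl | hb
        · simpa using Or.inr ha
        · exact Or.inr (by rw [map_add]; linarith)
    | smul t b _ ih =>
      change (t : ℝ) • b = 0 ∨ x ((t : ℝ) • b) < 0
      rcases ih with rfl | hb
      · simp
      · rcases t.2.eq_or_lt with h | h
        · left; rw [← h, zero_smul]
        · right; rw [map_smul]; exact mul_neg_of_pos_of_neg h hb
  have hAT : PointedCone.hull ℝ (A : Set V) ≤ PointedCone.hull ℝ (T : Set V) :=
    Submodule.span_mono (by simp [T])
  -- The expression is additive and positively homogeneous in `a` and in `b`, so it suffices to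
  -- check generators.
  have hcomb : ∀ a ∈ PointedCone.hull ℝ (A : Set V), ∀ b ∈ PointedCone.hull ℝ (B : Set V),
      x a • b + (-x b) • a ∈ PointedCone.hull ℝ (T : Set V) := by
    intro a ha b hb
    induction ha using Submodule.span_induction with
    | mem a ha =>
      induction hb using Submodule.span_induction with
      | mem b hb =>
        refine Submodule.subset_span (Finset.mem_coe.2 (Finset.mem_union_right _ ?_))
        exact Finset.mem_image.2 ⟨(a, b), Finset.mem_product.2 ⟨ha, hb⟩, rfl⟩
      | zero => simp
      | add b c _ _ ihb ihc =>
        have : x a • (b + c) + (-x (b + c)) • a =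
          (x a • b + (-x b) • a) + (x a • c + (-x c) • a) := by rw [map_add]; module
        rw [this]; exact Submodule.add_mem _ ihb ihc
      | smul t b _ ih =>
        have : x a • (t • b) + (-x (t • b)) • a = t • (x a • b + (-x b) • a) := by
          change x a • ((t : ℝ) • b) + (-x ((t : ℝ) • b)) • a = (t : ℝ) • (x a • b + (-x b) • a)
          rw [map_smul, smul_eq_mul]; module
        rw [this]; exact Submodule.smul_mem _ _ ih
    | zero => simp
    | add a c _ _ iha ihc =>
      have : x (a + c) • b + (-x b) • (a + c) =
        (x a • b + (-x b) • a) + (x c • b + (-x b) • c) := by rw [map_add]; module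
      rw [this]; exact Submodule.add_mem _ iha ihc
    | smul t a _ ih =>
      have : x (t • a) • b + (-x b) • (t • a) = t • (x a • b + (-x b) • a) := by
        change x ((t : ℝ) • a) • b + (-x b) • ((t : ℝ) • a) = (t : ℝ) • (x a • b + (-x b) • a)
        rw [map_smul, smul_eq_mul]; module
      rw [this]; exact Submodule.smul_mem _ _ ih
  refine ⟨T, fun v => ⟨fun hv => ?_, fun ⟨hv, hx⟩ => ?_⟩⟩
  · induction hv using Submodule.span_induction with
    | mem v hv =>
      rcases Finset.mem_union.1 (Finset.mem_coe.1 hv) with h | h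
      · exact ⟨Submodule.subset_span (hAS h), (Finset.mem_filter.1 h).2⟩
      · obtain ⟨⟨a, b⟩, hab, rfl⟩ := Finset.mem_image.1 h
        obtain ⟨ha, hb⟩ := Finset.mem_product.1 hab
        have hxa := (Finset.mem_filter.1 ha).2
        have hxb := (Finset.mem_filter.1 hb).2
        refine ⟨Submodule.add_mem _ ?_ ?_, ?_⟩
        · exact PointedCone.smul_mem _ hxa (Submodule.subset_span (hBS hb))
        · exact PointedCone.smul_mem _ (by simpa using hxb.le) (Submodule.subset_span (hAS ha))
        · simp only [map_add, map_smul, smul_eq_mul]; exact le_of_eq (by ring)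
    | zero => exact ⟨Submodule.zero_mem _, by simp⟩
    | add a b _ _ iha ihb =>
      exact ⟨Submodule.add_mem _ iha.1 ihb.1, by rw [map_add]; exact add_nonneg iha.2 ihb.2⟩
    | smul t a _ ih =>
      refine ⟨Submodule.smul_mem _ _ ih.1, ?_⟩
      change 0 ≤ x ((t : ℝ) • a)
      rw [map_smul]; exact mul_nonneg t.2 ih.2
  · have hS : PointedCone.hull ℝ (S : Set V) ≤
        PointedCone.hull ℝ (A : Set V) ⊔ PointedCone.hull ℝ (B : Set V) := by
      refine Submodule.span_le.2 fun s hs => ?_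
      rcases le_or_gt 0 (x s) with h | h
      · exact Submodule.mem_sup_left (Submodule.subset_span (Finset.mem_filter.2 ⟨hs, h⟩))
      · exact Submodule.mem_sup_right (Submodule.subset_span (Finset.mem_filter.2 ⟨hs, h⟩))
    obtain ⟨a, ha, b, hb, rfl⟩ := Submodule.mem_sup.1 (hS hv)
    rw [map_add] at hx
    rcases hBx b hb with rfl | hb'
    · simpa using hAT ha
    · have hpos : 0 < x a := by linarith
      -- The last coefficient is nonnegative exactly because `0 ≤ x (a + b)`.
      have : a + b = (x a)⁻¹ • (x a • b + (-x b) • a) + ((x a)⁻¹ * (x a + x b)) • a := by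
        have h1 := inv_mul_cancel₀ hpos.ne'
        rw [smul_add, smul_smul, smul_smul, h1, mul_add, h1]
        module
      rw [this]
      exact Submodule.add_mem _ (PointedCone.smul_mem _ (inv_nonneg.2 hpos.le) (hcomb a ha b hb))
        (PointedCone.smul_mem _ (mul_nonneg (inv_nonneg.2 hpos.le) hx) (hAT ha))

/-- Minkowski-Weyl: a cone cut out by finitely many forms is finitely generated. -/
lemma isPolyhedralCone_dualSet [Module.Finite ℝ V] (X : Finset (Module.Dual ℝ V)) :
    IsPolyhedralCone (dualSet X) := by
  classical
  induction X using Finset.induction_on with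
  | empty =>
    obtain ⟨S, hS⟩ := (Module.Finite.fg_top : (⊤ : Submodule ℝ V).FG)
    refine ⟨S ∪ S.image (fun s => -s), ?_⟩
    have hneg : ∀ s ∈ S, -s ∈ PointedCone.hull ℝ ((S ∪ S.image (fun s => -s) : Finset V) : Set V) :=
      fun s hs => Submodule.subset_span (by simp [hs])
    have hpos : ∀ s ∈ S, s ∈ PointedCone.hull ℝ ((S ∪ S.image (fun s => -s) : Finset V) : Set V) :=
      fun s hs => Submodule.subset_span (by simp [hs])
    refine Set.Subset.antisymm ?_ fun v _ => by simp [dualSet]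
    rintro v -
    have hv : v ∈ Submodule.span ℝ (S : Set V) := hS ▸ Submodule.mem_top
    -- Carrying `v` and `-v` together lets the induction pass through negative scalars.
    have : v ∈ PointedCone.hull ℝ ((S ∪ S.image (fun s => -s) : Finset V) : Set V) ∧
        -v ∈ PointedCone.hull ℝ ((S ∪ S.image (fun s => -s) : Finset V) : Set V) := by
      induction hv using Submodule.span_induction with
      | mem s hs => exact ⟨hpos s hs, hneg s hs⟩
      | zero => simp
      | add a b _ _ iha ihb =>
        exact ⟨Submodule.add_mem _ iha.1 ihb.1, neg_add a b ▸ Submodule.add_mem _ iha.2 ihb.2⟩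
      | smul t a _ ih =>
        rcases le_total 0 t with h | h
        · exact ⟨PointedCone.smul_mem _ h ih.1, smul_neg t a ▸ PointedCone.smul_mem _ h ih.2⟩
        · have h' : 0 ≤ -t := neg_nonneg.2 h
          exact ⟨neg_smul_neg t a ▸ PointedCone.smul_mem _ h' ih.2,
            neg_smul t a ▸ PointedCone.smul_mem _ h' ih.1⟩
    exact this.1
  | insert x X _ ih =>
    obtain ⟨S, hS⟩ := ih
    obtain ⟨T, hT⟩ := exists_finset_hull_inter_halfspace S x
    refine ⟨T, ?_⟩
    ext v
    rw [SetLike.mem_coe, hT, ← SetLike.mem_coe, ← hS]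
    simp [dualSet, and_comm]

/-- A finite collection of cones cut out by finitely many forms, closed under taking faces, is a
conic complex as soon as every member is extreme relative to every other one. -/
lemma isConicComplex_of_extreme [Module.Finite ℝ V] {Q : Set (Set V)} (hne : Q.Nonempty)
    (hfin : Q.Finite) (hdual : ∀ σ ∈ Q, ∃ X, σ = dualSet X)
    (hface : ∀ σ ∈ Q, ∀ F, IsFace F σ → F ∈ Q)
    (hext : ∀ σ ∈ Q, ∀ τ ∈ Q, ∀ a ∈ σ, ∀ b ∈ σ, a + b ∈ τ → a ∈ τ) : IsConicComplex Q := by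
  have hleft : ∀ σ ∈ Q, ∀ τ ∈ Q, IsFace (σ ∩ τ) σ := by
    intro σ hσ τ hτ
    have he := hext σ hσ τ hτ
    obtain ⟨X, rfl⟩ := hdual σ hσ
    obtain ⟨Y, rfl⟩ := hdual τ hτ
    exact isFace_of_extreme Set.inter_subset_left ⟨zero_mem_dualSet X, zero_mem_dualSet Y⟩
      (fun a ha b hb => ⟨add_mem_dualSet ha.1 hb.1, add_mem_dualSet ha.2 hb.2⟩)
      (fun t ht a ha => ⟨smul_mem_dualSet ht.le ha.1, smul_mem_dualSet ht.le ha.2⟩)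
      (fun a ha b hb hab => ⟨ha, he a ha b hb hab.2⟩)
  refine ⟨⟨hne, hfin, ?_, ?_, hface, ?_⟩, ?_⟩
  · intro σ hσ
    obtain ⟨X, rfl⟩ := hdual σ hσ
    exact isPolyhedron_dualSet X
  · intro σ hσ
    obtain ⟨X, rfl⟩ := hdual σ hσ
    exact ⟨0, zero_mem_dualSet X⟩
  · intro σ hσ τ hτ
    exact Or.inr ⟨hleft σ hσ τ hτ, Set.inter_comm τ σ ▸ hleft τ hτ σ hσ⟩
  · intro σ hσ
    obtain ⟨X, rfl⟩ := hdual σ hσ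
    exact isPolyhedralCone_dualSet X

end MinkowskiWeyl

end PolyComplex
namespace PolyComplex

/-! ### Recession cones of polyhedra -/

section Recession

variable {V : Type*} [AddCommGroup V] [Module ℝ V]

lemma nonneg_of_forall_large {a b c t₀ : ℝ} (h : ∀ t, t₀ ≤ t → c ≤ a + t * b) : 0 ≤ b := by
  by_contra hb
  push Not at hb
  have h1 := h (max t₀ ((c - a - 1) / b)) (le_max_left _ _)
  have h2 := mul_le_mul_of_nonpos_right (le_max_right t₀ ((c - a - 1) / b)) hb.le
  rw [div_mul_cancel₀ _ hb.ne] at h2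
  linarith

/-- Boundedness below along a ray constrains only its slope, so the constants disappear.
Non-emptiness is needed: the recession cone of `∅` is the whole space. -/
lemma mem_recCone_halfspaceInter {H : Finset (Module.Dual ℝ V × ℝ)}
    (hne : (halfspaceInter H).Nonempty) {u : V} :
    u ∈ recCone (halfspaceInter H) ↔ ∀ h ∈ H, 0 ≤ h.1 u := by
  constructor
  · intro hu h hh
    obtain ⟨p, hp⟩ := hne
    refine nonneg_of_forall_large (t₀ := 0) (a := h.1 p) (c := h.2) fun t ht => ?_
    simpa using Set.mem_iInter₂.1 hu p hp t ht h hh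
  · intro hu
    refine Set.mem_iInter₂.2 fun p hp t ht h hh => ?_
    rw [map_add, map_smul, smul_eq_mul]
    linarith [hp h hh, mul_nonneg ht (hu h hh)]

lemma recCone_halfspaceInter [DecidableEq (Module.Dual ℝ V)]
    {H : Finset (Module.Dual ℝ V × ℝ)} (hne : (halfspaceInter H).Nonempty) :
    recCone (halfspaceInter H) = dualSet (H.image Prod.fst) := by
  ext u
  rw [mem_recCone_halfspaceInter hne]
  simp [dualSet]

lemma IsPolyhedron.exists_recCone_eq_dualSet {E : Set V} (hE : IsPolyhedron E)
    (hne : E.Nonempty) : ∃ X, recCone E = dualSet X := by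
  classical
  obtain ⟨H, rfl⟩ := hE
  exact ⟨_, recCone_halfspaceInter hne⟩

lemma add_smul_mem_of_mem_recCone {E : Set V} {p u : V} (hp : p ∈ E) (hu : u ∈ recCone E)
    {t : ℝ} (ht : 0 ≤ t) : p + t • u ∈ E :=
  Set.mem_iInter₂.1 hu p hp t ht

/-- A polyhedron that contains a ray has the direction of this ray in its recession cone. -/
lemma IsPolyhedron.mem_recCone {E : Set V} (hE : IsPolyhedron E) {p u : V} {t₀ : ℝ}
    (h : ∀ t : ℝ, t₀ ≤ t → p + t • u ∈ E) : u ∈ recCone E := by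
  obtain ⟨H, rfl⟩ := hE
  refine (mem_recCone_halfspaceInter ⟨_, h t₀ le_rfl⟩).2 fun x hx => ?_
  refine nonneg_of_forall_large (a := x.1 p) (c := x.2) (t₀ := t₀) fun t ht => ?_
  simpa using h t ht x hx

lemma containsNoLine_recCone {E : Set V} (hE : IsPolyhedron E) (hne : E.Nonempty)
    (h : ContainsNoLine E) : ContainsNoLine (recCone E) := by
  classical
  rintro ⟨p, v, hv, hl⟩
  obtain ⟨H, rfl⟩ := hE
  rw [recCone_halfspaceInter hne] at hl
  have h0 := eq_zero_of_line_subset_dualSet hl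
  obtain ⟨q, hq⟩ := hne
  refine h ⟨q, v, hv, fun t x hx => ?_⟩
  have := h0 x.1 (Finset.mem_image_of_mem _ hx)
  simpa [this] using hq x hx

lemma isRationalPolyhedron_recCone {L : Submodule ℤ V} {E : Set V} (hne : E.Nonempty)
    (h : IsRationalPolyhedron L E) : IsRationalPolyhedron L (recCone E) := by
  classical
  obtain ⟨H, hH, rfl⟩ := h
  rw [recCone_halfspaceInter hne]
  refine isRationalPolyhedron_dualSet L _ fun x hx => ?_
  obtain ⟨h, hh, rfl⟩ := Finset.mem_image.1 hx
  exact (hH h hh).1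

/-- The recession cone of the face of `E` cut out by `x`. -/
lemma mem_recCone_minSet {E : Set V} (hE : IsPolyhedron E) {x : Module.Dual ℝ V}
    (hne : (minSet E x).Nonempty) {u : V} :
    u ∈ recCone (minSet E x) ↔ u ∈ recCone E ∧ x u = 0 := by
  constructor
  · intro hu
    obtain ⟨p, hp⟩ := hne
    have hmem : ∀ t : ℝ, 0 ≤ t → p + t • u ∈ minSet E x := fun t ht =>
      add_smul_mem_of_mem_recCone hp hu ht
    refine ⟨hE.mem_recCone fun t ht => (hmem t ht).1, ?_⟩
    have h1 := (hmem 1 zero_le_one).2 p hp.1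
    have h2 := hp.2 _ (hmem 1 zero_le_one).1
    simp only [map_add, one_smul] at h1 h2
    linarith
  · rintro ⟨hu, hx⟩
    refine Set.mem_iInter₂.2 fun p hp t ht => ⟨add_smul_mem_of_mem_recCone hp.1 hu ht, ?_⟩
    simpa [hx] using hp.2

end Recession

/-! ### The cone over a polyhedron: equations, minima and faces -/

section ConeOf

variable {V : Type*} [NormedAddCommGroup V] [NormedSpace ℝ V]

/-- The linear form `(v, t) ↦ x v - b t` that homogenizes the inequality `b ≤ x v`. -/
def homogenize (h : Module.Dual ℝ V × ℝ) : Module.Dual ℝ (V × ℝ) :=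
  h.1 ∘ₗ LinearMap.fst ℝ V ℝ - h.2 • LinearMap.snd ℝ V ℝ

@[simp] lemma homogenize_apply (h : Module.Dual ℝ V × ℝ) (w : V × ℝ) :
    homogenize h w = h.1 w.1 - h.2 * w.2 := rfl

lemma eq_smul_mk_one {w : V × ℝ} (h : 0 < w.2) : w = w.2 • (w.2⁻¹ • w.1, (1 : ℝ)) := by
  rw [Prod.smul_mk, smul_smul, mul_inv_cancel₀ h.ne', one_smul, smul_eq_mul, mul_one]

lemma isClosed_dualSet [FiniteDimensional ℝ V] (X : Finset (Module.Dual ℝ V)) :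
    IsClosed (dualSet X) := by
  have : dualSet X = ⋂ x ∈ X, {u | 0 ≤ x u} := by ext; simp [dualSet]
  rw [this]
  exact isClosed_biInter fun x _ =>
    isClosed_le continuous_const (LinearMap.continuous_of_finiteDimensional x)

lemma coneOf_aux_subset [DecidableEq (Module.Dual ℝ (V × ℝ))]
    {H : Finset (Module.Dual ℝ V × ℝ)} {w : V × ℝ}
    (hw : ∃ t : ℝ, 0 < t ∧ ∃ u ∈ halfspaceInter H, w = t • (u, (1 : ℝ))) :
    w ∈ dualSet (insert (LinearMap.snd ℝ V ℝ) (H.image homogenize)) := by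
  obtain ⟨t, ht, u, hu, rfl⟩ := hw
  intro x hx
  rcases Finset.mem_insert.1 hx with rfl | hx
  · simpa using ht.le
  · obtain ⟨h, hh, rfl⟩ := Finset.mem_image.1 hx
    have := mul_le_mul_of_nonneg_left (hu h hh) ht.le
    simp only [homogenize_apply, Prod.smul_mk, map_smul, smul_eq_mul, mul_one]
    linarith

lemma mem_of_mem_dualSet_homogenize [DecidableEq (Module.Dual ℝ (V × ℝ))]
    {H : Finset (Module.Dual ℝ V × ℝ)} {w : V × ℝ}
    (hw : w ∈ dualSet (insert (LinearMap.snd ℝ V ℝ) (H.image homogenize))) (ht : 0 < w.2) :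
    w.2⁻¹ • w.1 ∈ halfspaceInter H := by
  intro h hh
  have := hw (homogenize h) (Finset.mem_insert_of_mem (Finset.mem_image_of_mem _ hh))
  rw [homogenize_apply] at this
  rw [map_smul, smul_eq_mul, inv_mul_eq_div, le_div_iff₀ ht]
  linarith

/-- The homogenized inequalities together with `0 ≤ t` define a closed cone. Conversely, adding `ε •
(p, 1)` with `p` in the polyhedron and `ε → 0⁺` approximates every solution by solutions of positive
height, which lie over the polyhedron. -/
lemma coneOf_halfspaceInter [FiniteDimensional ℝ V] [DecidableEq (Module.Dual ℝ (V × ℝ))]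
    {H : Finset (Module.Dual ℝ V × ℝ)} (hne : (halfspaceInter H).Nonempty) :
    coneOf (halfspaceInter H) =
      dualSet (insert (LinearMap.snd ℝ V ℝ) (H.image homogenize)) := by
  refine Set.Subset.antisymm
    (closure_minimal (fun w hw => coneOf_aux_subset hw) (isClosed_dualSet _)) ?_
  obtain ⟨p, hp⟩ := hne
  intro w hw
  have hp1 : ((p, (1 : ℝ)) : V × ℝ) ∈
      dualSet (insert (LinearMap.snd ℝ V ℝ) (H.image homogenize)) :=
    coneOf_aux_subset ⟨1, one_pos, p, hp, by simp⟩
  have hw2 : 0 ≤ w.2 := hw (LinearMap.snd ℝ V ℝ) (Finset.mem_insert_self _ _)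
  have hlim : Filter.Tendsto (fun ε : ℝ => w + ε • ((p, (1 : ℝ)) : V × ℝ))
      (nhdsWithin 0 (Set.Ioi 0)) (nhds w) := by
    have : Continuous fun ε : ℝ => w + ε • ((p, (1 : ℝ)) : V × ℝ) := by fun_prop
    simpa using (this.tendsto 0).mono_left nhdsWithin_le_nhds
  refine mem_closure_of_tendsto hlim (eventually_nhdsWithin_of_forall fun ε hε => ?_)
  have hε : 0 < ε := hε
  have hpos : 0 < (w + ε • ((p, (1 : ℝ)) : V × ℝ)).2 := by
    simp only [Prod.snd_add, Prod.smul_snd, smul_eq_mul, mul_one]; linarith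
  refine ⟨_, hpos, _, mem_of_mem_dualSet_homogenize
    (add_mem_dualSet hw (smul_mem_dualSet hε.le hp1)) hpos, eq_smul_mk_one hpos⟩

lemma IsPolyhedron.exists_coneOf_eq_dualSet [FiniteDimensional ℝ V] {E : Set V}
    (hE : IsPolyhedron E) (hne : E.Nonempty) : ∃ X, coneOf E = dualSet X := by
  classical
  obtain ⟨H, rfl⟩ := hE
  exact ⟨_, coneOf_halfspaceInter hne⟩

/-- The slices of the cone: rescaled copies of `E` at positive height, the recession cone at height
zero. Later arguments use this in place of the closure. -/
lemma mem_coneOf_iff [FiniteDimensional ℝ V] {E : Set V} (hE : IsPolyhedron E)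
    (hne : E.Nonempty) {w : V × ℝ} :
    w ∈ coneOf E ↔ (0 < w.2 ∧ w.2⁻¹ • w.1 ∈ E) ∨ (w.2 = 0 ∧ w.1 ∈ recCone E) := by
  classical
  obtain ⟨H, rfl⟩ := hE
  have hc := coneOf_halfspaceInter hne
  have hrec : w.2 = 0 → (w ∈ coneOf (halfspaceInter H) ↔ w.1 ∈ recCone (halfspaceInter H)) := by
    intro h0
    rw [hc, mem_recCone_halfspaceInter hne]
    simp only [dualSet, Set.mem_ofPred_eq, Finset.forall_mem_insert, Finset.forall_mem_image,
      LinearMap.snd_apply, homogenize_apply, h0, mul_zero, sub_zero, le_refl, true_and]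
  constructor
  · intro hw
    have hw' := hw
    rw [hc] at hw'
    have hw2 : 0 ≤ w.2 := hw' (LinearMap.snd ℝ V ℝ) (Finset.mem_insert_self _ _)
    rcases hw2.eq_or_lt with h | h
    · exact Or.inr ⟨h.symm, (hrec h.symm).1 hw⟩
    · exact Or.inl ⟨h, mem_of_mem_dualSet_homogenize hw' h⟩
  · rintro (⟨h, hw⟩ | ⟨h, hw⟩)
    · exact subset_closure ⟨w.2, h, _, hw, eq_smul_mk_one h⟩
    · exact (hrec h).2 hw

lemma mk_one_mem_coneOf {E : Set V} {p : V} (hp : p ∈ E) : (p, (1 : ℝ)) ∈ coneOf E :=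
  subset_closure ⟨1, one_pos, p, hp, by simp⟩

lemma snd_nonneg_of_mem_coneOf [FiniteDimensional ℝ V] {E : Set V} (hE : IsPolyhedron E)
    (hne : E.Nonempty) {w : V × ℝ} (hw : w ∈ coneOf E) : 0 ≤ w.2 := by
  rcases (mem_coneOf_iff hE hne).1 hw with h | h
  exacts [h.1.le, h.1.ge]

lemma containsNoLine_coneOf [FiniteDimensional ℝ V] {E : Set V} (hE : IsPolyhedron E)
    (hne : E.Nonempty) (h : ContainsNoLine E) : ContainsNoLine (coneOf E) := by
  classical
  rintro ⟨p, v, hv, hl⟩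
  obtain ⟨H, rfl⟩ := hE
  rw [coneOf_halfspaceInter hne] at hl
  have h0 := eq_zero_of_line_subset_dualSet hl
  have hv2 : v.2 = 0 := h0 (LinearMap.snd ℝ V ℝ) (Finset.mem_insert_self _ _)
  have hv1 : v.1 ≠ 0 := fun h1 => hv (Prod.ext h1 hv2)
  obtain ⟨q, hq⟩ := hne
  refine h ⟨q, v.1, hv1, fun t x hx => ?_⟩
  have := h0 (homogenize x) (Finset.mem_insert_of_mem (Finset.mem_image_of_mem _ hx))
  rw [homogenize_apply, hv2, mul_zero, sub_zero] at this
  simpa [this] using hq x hx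

lemma isRationalPolyhedron_coneOf [FiniteDimensional ℝ V] {L : Submodule ℤ V} {E : Set V}
    (hne : E.Nonempty) (h : IsRationalPolyhedron L E) :
    IsRationalPolyhedron (latticeProdInt L) (coneOf E) := by
  classical
  obtain ⟨H, hH, rfl⟩ := h
  rw [coneOf_halfspaceInter hne]
  refine isRationalPolyhedron_dualSet _ _ fun x hx l hl => ?_
  obtain ⟨hl1, hl2⟩ := Submodule.mem_prod.1 hl
  obtain ⟨n, hn⟩ := Submodule.mem_span_singleton.1 hl2
  have hn : l.2 = n := by rw [← hn]; simp
  rcases Finset.mem_insert.1 hx with rfl | hx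
  · exact ⟨n, by simp [hn]⟩
  · obtain ⟨h, hh, rfl⟩ := Finset.mem_image.1 hx
    obtain ⟨q, hq⟩ := (hH h hh).1 l.1 hl1
    obtain ⟨r, hr⟩ := (hH h hh).2
    exact ⟨q - r * n, by rw [homogenize_apply, hq, hr, hn]; push_cast; ring⟩

/-- The cone `C × {0}`, for a cone `C` cut out by linear forms. -/
lemma dualSet_prod_zero [DecidableEq (Module.Dual ℝ (V × ℝ))] (X : Finset (Module.Dual ℝ V)) :
    dualSet X ×ˢ {(0 : ℝ)} = dualSet (insert (LinearMap.snd ℝ V ℝ)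
      (insert (-LinearMap.snd ℝ V ℝ) (X.image fun x => x ∘ₗ LinearMap.fst ℝ V ℝ))) := by
  ext w
  simp only [dualSet, Set.mem_prod, Set.mem_ofPred_eq, Set.mem_singleton_iff,
    Finset.forall_mem_insert, Finset.forall_mem_image, LinearMap.snd_apply, LinearMap.neg_apply,
    LinearMap.comp_apply, LinearMap.fst_apply, Left.nonneg_neg_iff]
  constructor
  · exact fun h => ⟨h.2.ge, h.2.le, h.1⟩
  · exact fun h => ⟨h.2.2, le_antisymm h.2.1 h.1⟩

lemma containsNoLine_prod_zero {C : Set V} (h : ContainsNoLine C) :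
    ContainsNoLine (C ×ˢ {(0 : ℝ)}) := by
  rintro ⟨p, v, hv, hl⟩
  have h0 : p.2 = 0 := by simpa using (hl 0).2
  have h1 : p.2 + v.2 = 0 := by simpa using (hl 1).2
  have hv2 : v.2 = 0 := by linarith
  exact h ⟨p.1, v.1, fun h1 => hv (Prod.ext h1 hv2), fun t => by simpa using (hl t).1⟩

lemma isRationalPolyhedron_recCone_prod_zero {L : Submodule ℤ V} {E : Set V} (hne : E.Nonempty)
    (h : IsRationalPolyhedron L E) :
    IsRationalPolyhedron (latticeProdInt L) (recCone E ×ˢ {(0 : ℝ)}) := by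
  classical
  obtain ⟨H, hH, rfl⟩ := h
  rw [recCone_halfspaceInter hne, dualSet_prod_zero]
  refine isRationalPolyhedron_dualSet _ _ fun x hx l hl => ?_
  obtain ⟨hl1, hl2⟩ := Submodule.mem_prod.1 hl
  obtain ⟨n, hn⟩ := Submodule.mem_span_singleton.1 hl2
  have hn : l.2 = n := by rw [← hn]; simp
  rcases Finset.mem_insert.1 hx with rfl | hx
  · exact ⟨n, by simp [hn]⟩
  rcases Finset.mem_insert.1 hx with rfl | hx
  · exact ⟨-n, by simp [hn]⟩
  · obtain ⟨y, hy, rfl⟩ := Finset.mem_image.1 hx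
    obtain ⟨h, hh, rfl⟩ := Finset.mem_image.1 hy
    exact (hH h hh).1 l.1 hl1

/-- A linear form that is nonnegative on the recession cone of a nonempty polyhedron attains its
minimum on the polyhedron. -/
lemma minSet_nonempty [FiniteDimensional ℝ V] {E : Set V} (hE : IsPolyhedron E)
    (hne : E.Nonempty) {x : Module.Dual ℝ V} (hx : ∀ u ∈ recCone E, 0 ≤ x u) :
    (minSet E x).Nonempty := by
  classical
  obtain ⟨X, hX⟩ := hE.exists_coneOf_eq_dualSet hne
  obtain ⟨S, hS⟩ := isPolyhedralCone_dualSet X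
  rw [← hX] at hS
  have hSE : ∀ s ∈ S, s ∈ coneOf E := fun s hs => by
    rw [hS]; exact Submodule.subset_span hs
  have hnonneg : ∀ y : Module.Dual ℝ (V × ℝ), (∀ s ∈ S, 0 ≤ y s) → ∀ w ∈ coneOf E, 0 ≤ y w := by
    intro y hy w hw
    rw [hS] at hw
    induction (SetLike.mem_coe.1 hw) using Submodule.span_induction with
    | mem s hs => exact hy s hs
    | zero => simp
    | add a b ha hb iha ihb => rw [map_add]; exact add_nonneg (iha ha) (ihb hb)
    | smul t a ha ih =>
      change 0 ≤ y ((t : ℝ) • a)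
      rw [map_smul]; exact mul_nonneg t.2 (ih ha)
  -- Otherwise the whole cone would lie in heights at most zero, although it contains `(p, 1)`.
  have hpos : (S.filter fun s => 0 < s.2).Nonempty := by
    by_contra hemp
    rw [Finset.not_nonempty_iff_eq_empty, Finset.filter_eq_empty_iff] at hemp
    obtain ⟨p, hp⟩ := hne
    have := hnonneg (-LinearMap.snd ℝ V ℝ) (fun s hs => by simpa using hemp hs) _
      (mk_one_mem_coneOf hp)
    simp at this
    linarith
  -- Generators of positive height rescale to points of `E`; the best of these finitely many points
  -- is the minimizer.
  obtain ⟨s₀, hs₀, hmin⟩ := Finset.exists_min_image _ (fun s => x s.1 / s.2) hpos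
  obtain ⟨hs₀S, hs₀pos⟩ := Finset.mem_filter.1 hs₀
  -- Generators of positive height are handled by the choice of `s₀`, those of height zero by `hx`.
  have hbound := hnonneg (homogenize (x, x s₀.1 / s₀.2)) fun s hs => by
    rw [homogenize_apply]
    rcases (mem_coneOf_iff hE hne).1 (hSE s hs) with ⟨h, -⟩ | ⟨h, hrec⟩
    · have := hmin s (Finset.mem_filter.2 ⟨hs, h⟩)
      rw [le_div_iff₀ h] at this
      exact sub_nonneg.2 this
    · rw [h, mul_zero, sub_zero]; exact hx _ hrec
  have hmem : s₀.2⁻¹ • s₀.1 ∈ E := by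
    rcases (mem_coneOf_iff hE hne).1 (hSE s₀ hs₀S) with h | h
    · exact h.2
    · exact absurd h.1 hs₀pos.ne'
  refine ⟨_, hmem, fun u hu => ?_⟩
  have := hbound _ (mk_one_mem_coneOf hu)
  rw [homogenize_apply] at this
  rw [map_smul, smul_eq_mul, inv_mul_eq_div]
  linarith

/-- The faces of the recession cone of a polyhedron are the recession cones of its faces. -/
lemma exists_face_of_isFace_recCone [FiniteDimensional ℝ V] {E : Set V} (hE : IsPolyhedron E)
    (hne : E.Nonempty) {F : Set V} (hF : IsFace F (recCone E)) :
    ∃ G, IsFace G E ∧ F = recCone G := by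
  obtain ⟨hFne, x, rfl⟩ := hF
  obtain ⟨X, hX⟩ := hE.exists_recCone_eq_dualSet hne
  rw [hX] at hFne
  obtain ⟨hx, hF⟩ := nonneg_and_minSet_eq_of_nonempty hFne
  rw [← hX] at hx hF
  have hG := minSet_nonempty hE hne hx
  refine ⟨minSet E x, ⟨hG, x, rfl⟩, ?_⟩
  rw [hF]
  ext u
  exact (mem_recCone_minSet hE hG).symm

lemma isFace_prod_zero {C : Set V} {F : Set (V × ℝ)} (hF : IsFace F (C ×ˢ {(0 : ℝ)})) :
    ∃ G, IsFace G C ∧ F = G ×ˢ {(0 : ℝ)} := by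
  obtain ⟨⟨w, hw⟩, y, rfl⟩ := hF
  have hy : ∀ v : V, ∀ t : ℝ, t = 0 → y (v, t) = (y ∘ₗ LinearMap.inl ℝ V ℝ) v := by
    rintro v _ rfl; rfl
  have key : minSet (C ×ˢ {(0 : ℝ)}) y = minSet C (y ∘ₗ LinearMap.inl ℝ V ℝ) ×ˢ {(0 : ℝ)} := by
    ext ⟨v, t⟩
    constructor
    · rintro ⟨⟨hv, ht⟩, hmin⟩
      exact ⟨⟨hv, fun z hz => by simpa [hy v t ht] using hmin (z, 0) ⟨hz, rfl⟩⟩, ht⟩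
    · rintro ⟨⟨hv, hmin⟩, ht⟩
      refine ⟨⟨hv, ht⟩, ?_⟩
      rintro ⟨z, r⟩ ⟨hz, hr⟩
      rw [hy v t ht, hy z r hr]
      exact hmin z hz
  exact ⟨_, ⟨⟨w.1, (key ▸ hw).1⟩, _, rfl⟩, key⟩

/-- A face of the cone of a polyhedron `E` is the cone of a face `G` of `E`, or is
`rec(G) × {0}`. -/
lemma exists_face_of_isFace_coneOf [FiniteDimensional ℝ V] {E : Set V} (hE : IsPolyhedron E)
    (hne : E.Nonempty) (hface : ∀ G, IsFace G E → IsPolyhedron G) {F : Set (V × ℝ)}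
    (hF : IsFace F (coneOf E)) :
    ∃ G, IsFace G E ∧ (F = coneOf G ∨ F = recCone G ×ˢ {(0 : ℝ)}) := by
  obtain ⟨hFne, y, rfl⟩ := hF
  obtain ⟨X, hX⟩ := hE.exists_coneOf_eq_dualSet hne
  rw [hX] at hFne
  obtain ⟨hy, hF⟩ := nonneg_and_minSet_eq_of_nonempty hFne
  rw [← hX] at hy hF
  let x : Module.Dual ℝ V := y ∘ₗ LinearMap.inl ℝ V ℝ
  let β : ℝ := y (0, 1)
  have hyw : ∀ w : V × ℝ, y w = x w.1 + w.2 * β := by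
    rintro ⟨v, t⟩
    have : ((v, t) : V × ℝ) = (v, 0) + t • (0, 1) := by simp
    rw [this, map_add, map_smul, smul_eq_mul]
    simp [x, β]
  have hxE : ∀ u ∈ E, 0 ≤ x u + β := fun u hu => by
    simpa [hyw] using hy _ (mk_one_mem_coneOf hu)
  have hxrec : ∀ u ∈ recCone E, 0 ≤ x u := fun u hu => by
    simpa [hyw] using hy (u, 0) ((mem_coneOf_iff hE hne).2 (Or.inr ⟨rfl, hu⟩))
  have hG := minSet_nonempty hE hne hxrec
  have hGface : IsFace (minSet E x) E := ⟨hG, x, rfl⟩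
  have hyt : ∀ w : V × ℝ, 0 < w.2 → (y w = 0 ↔ x (w.2⁻¹ • w.1) + β = 0) := fun w hw => by
    have : y w = w.2 * (x (w.2⁻¹ • w.1) + β) := by
      rw [hyw, map_smul, smul_eq_mul]; field_simp
    rw [this, mul_eq_zero, or_iff_right hw.ne']
  refine ⟨minSet E x, hGface, ?_⟩
  rw [hF]
  -- Since `x + β ≥ 0` on `E`, either its minimum is zero and the face reaches positive heights, or
  -- it is positive on `E` and the face lies at height zero.
  by_cases hβ : ∃ p ∈ E, x p + β = 0
  · left
    obtain ⟨p, hp, hpβ⟩ := hβ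
    ext w
    rw [mem_coneOf_iff (hface _ hGface) hG, mem_recCone_minSet hE hG, Set.mem_ofPred_eq,
      mem_coneOf_iff hE hne]
    constructor
    · rintro ⟨⟨ht, hw⟩ | ⟨ht, hw⟩, h0⟩
      · refine Or.inl ⟨ht, hw, fun v hv => ?_⟩
        linarith [(hyt w ht).1 h0, hxE v hv]
      · refine Or.inr ⟨ht, hw, ?_⟩
        rwa [hyw, ht, zero_mul, add_zero] at h0
    · rintro (⟨ht, hw, hmin⟩ | ⟨ht, hw, h0⟩)
      · refine ⟨Or.inl ⟨ht, hw⟩, (hyt w ht).2 ?_⟩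
        linarith [hmin p hp, hxE _ hw]
      · exact ⟨Or.inr ⟨ht, hw⟩, by rw [hyw, ht, zero_mul, add_zero, h0]⟩
  · right
    ext w
    rw [Set.mem_prod, mem_recCone_minSet hE hG, Set.mem_ofPred_eq, mem_coneOf_iff hE hne,
      Set.mem_singleton_iff]
    constructor
    · rintro ⟨⟨ht, hw⟩ | ⟨ht, hw⟩, h0⟩
      · exact absurd ⟨_, hw, (hyt w ht).1 h0⟩ hβ
      · rw [hyw, ht, zero_mul, add_zero] at h0
        exact ⟨⟨hw, h0⟩, ht⟩
    · rintro ⟨⟨hw, h0⟩, ht⟩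
      exact ⟨Or.inr ⟨ht, hw⟩, by rw [hyw, ht, zero_mul, add_zero, h0]⟩

end ConeOf

end PolyComplex
namespace PolyComplex

/-! ### Extremality of recession cones under convex support -/

section KeyLemma

variable {V : Type*} [AddCommGroup V] [Module ℝ V]

/-- For `Λ` meeting `Λ'` in a common face, the set `rec(Λ) ∩ rec(Λ')` is extreme in `rec(Λ)`. -/
lemma IsPolyhedralComplex.recCone_extreme_of_mem_inter {P : Set (Set V)}
    (hP : IsPolyhedralComplex P) {Λ Λ' : Set V} (hΛ : Λ ∈ P) (hΛ' : Λ' ∈ P) {z : V}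
    (hz : z ∈ Λ) (hz' : z ∈ Λ') {v w : V} (hv : v ∈ recCone Λ) (hw : w ∈ recCone Λ)
    (hvw : v + w ∈ recCone Λ') : v ∈ recCone Λ' := by
  obtain ⟨⟨-, x, hx⟩, -⟩ :=
    (hP.inter Λ hΛ Λ' hΛ').resolve_left fun h => Set.disjoint_left.1 h hz hz'
  have hmem : ∀ {p}, p ∈ Λ → p ∈ Λ' → p ∈ minSet Λ x := fun h h' => hx ▸ ⟨h, h'⟩
  have hzm := hmem hz hz'
  -- Minimality at `z` gives `x v ≥ 0` and `x w ≥ 0`. As `z + v + w` lies in both polyhedra, hence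
  -- in the face, also `x (v + w) ≤ 0`, so `x v = 0`.
  have h1 := hzm.2 _ (add_smul_mem_of_mem_recCone hz hv zero_le_one)
  have h2 := hzm.2 _ (add_smul_mem_of_mem_recCone hz hw zero_le_one)
  have h3 : z + (1 : ℝ) • (v + w) ∈ Λ := by
    have := add_smul_mem_of_mem_recCone (add_smul_mem_of_mem_recCone hz hv zero_le_one) hw
      zero_le_one
    simpa [add_assoc] using this
  have h4 := (hmem h3 (add_smul_mem_of_mem_recCone hz' hvw zero_le_one)).2 _ hz
  simp only [one_smul, map_add] at h1 h2 h4
  have hxv : x v = 0 := by linarith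
  refine (hP.isPolyhedron Λ' hΛ').mem_recCone (p := z) (t₀ := 0) fun t ht => ?_
  have : z + t • v ∈ minSet Λ x :=
    ⟨add_smul_mem_of_mem_recCone hz hv ht, by simpa [hxv] using hzm.2⟩
  rw [← hx] at this
  exact this.2

/-- If a ray meets a polyhedron at arbitrarily large integer times, it eventually stays in it. -/
lemma IsPolyhedron.eventually_mem_of_infinite {E : Set V} (hE : IsPolyhedron E) {p u : V}
    (h : {n : ℕ | p + (n : ℝ) • u ∈ E}.Infinite) :
    ∃ t₀ : ℝ, ∀ t : ℝ, t₀ ≤ t → p + t • u ∈ E := by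
  obtain ⟨H, rfl⟩ := hE
  obtain ⟨n₀, hn₀⟩ := h.nonempty
  refine ⟨n₀, fun t ht x hx => ?_⟩
  have hb : 0 ≤ x.1 u := by
    by_contra hb
    push Not at hb
    obtain ⟨N, hN⟩ := exists_nat_gt ((x.2 - x.1 p) / x.1 u)
    obtain ⟨n, hn, hNn⟩ := h.exists_gt N
    have h1 := hn x hx
    rw [map_add, map_smul, smul_eq_mul] at h1
    have h2 : ((x.2 - x.1 p) / x.1 u) < n := hN.trans (by exact_mod_cast hNn)
    rw [div_lt_iff_of_neg hb] at h2
    linarith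
  have h1 := hn₀ x hx
  rw [map_add, map_smul, smul_eq_mul] at h1 ⊢
  nlinarith

/-- The parameters `s` for which the ray from `p + s d` in the direction `u` eventually stays in a
given polyhedron form a closed set. -/
lemma IsPolyhedron.isClosed_eventually_mem {E : Set V} (hE : IsPolyhedron E) (p d u : V) :
    IsClosed {s : ℝ | ∃ t₀ : ℝ, ∀ t : ℝ, t₀ ≤ t → (p + s • d) + t • u ∈ E} := by
  classical
  obtain ⟨H, rfl⟩ := hE
  -- If no form decreases along `u`, only those constant along `u` constrain `s`, through closed
  -- conditions affine in `s`. If some form decreases, no ray stays inside.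
  by_cases hu : ∀ h ∈ H, 0 ≤ h.1 u
  · have : {s : ℝ | ∃ t₀ : ℝ, ∀ t : ℝ, t₀ ≤ t → (p + s • d) + t • u ∈ halfspaceInter H} =
        ⋂ h ∈ H.filter fun h => h.1 u = 0, {s : ℝ | h.2 ≤ h.1 p + s * h.1 d} := by
      ext s
      simp only [Set.mem_iInter₂, Set.mem_ofPred_eq, Finset.mem_filter]
      constructor
      · rintro ⟨t₀, ht₀⟩ h ⟨hh, h0⟩
        simpa [h0] using ht₀ t₀ le_rfl h hh
      · intro hs
        have : ∀ h ∈ H, ∀ᶠ t : ℝ in Filter.atTop, h.2 ≤ h.1 ((p + s • d) + t • u) := by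
          intro h hh
          simp only [map_add, map_smul, smul_eq_mul]
          rcases (hu h hh).eq_or_lt with h0 | h0
          · exact Filter.Eventually.of_forall fun t => by
              simpa [← h0] using hs h ⟨hh, h0.symm⟩
          · filter_upwards [Filter.eventually_ge_atTop
              ((h.2 - (h.1 p + s * h.1 d)) / h.1 u)] with t ht
            rw [div_le_iff₀ h0] at ht
            linarith
        exact Filter.eventually_atTop.1 ((Filter.eventually_all_finset H).2 this)
    rw [this]
    exact isClosed_biInter fun h _ => isClosed_le (by fun_prop) (by fun_prop)
  · push Not at hu
    obtain ⟨h, hh, hneg⟩ := hu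
    convert isClosed_empty
    refine Set.eq_empty_of_forall_notMem ?_
    rintro s ⟨t₀, ht₀⟩
    refine hneg.not_ge (nonneg_of_forall_large (a := h.1 (p + s • d)) (c := h.2) (t₀ := t₀)
      fun t ht => ?_)
    simpa using ht₀ t ht h hh

/-- A ray in the support of a complex is eventually contained in one of the polyhedra. -/
lemma IsPolyhedralComplex.exists_eventually_mem {P : Set (Set V)} (hP : IsPolyhedralComplex P)
    {p u : V} (h : ∀ t : ℝ, 0 ≤ t → p + t • u ∈ support P) :
    ∃ Λ ∈ P, ∃ t₀ : ℝ, ∀ t : ℝ, t₀ ≤ t → p + t • u ∈ Λ := by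
  -- Pigeonhole on integer times: one of the finitely many polyhedra is met infinitely often.
  have hcover : (Set.univ : Set ℕ) ⊆ ⋃ Λ ∈ P, {n : ℕ | p + (n : ℝ) • u ∈ Λ} := fun n _ => by
    simpa [support] using h n n.cast_nonneg
  by_contra hcon
  push Not at hcon
  refine Set.infinite_univ (Set.Finite.subset (hP.finite.biUnion fun Λ hΛ => ?_) hcover)
  by_contra hinf
  obtain ⟨t₀, ht₀⟩ := (hP.isPolyhedron Λ hΛ).eventually_mem_of_infinite hinf
  obtain ⟨t, ht, hnot⟩ := hcon Λ hΛ t₀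
  exact hnot (ht₀ t ht)

/-- For a polyhedral complex with convex support, the set `rec(Λ) ∩ rec(Λ')` is extreme in
`rec(Λ)`, for any two members `Λ` and `Λ'`. One joins a point of `Λ` to a point of `Λ'`: each ray
with origin on the segment and direction `v + w` eventually lies in a member of the complex, and
these members form a chain in which neighbours meet. -/
lemma IsPolyhedralComplex.recCone_extreme {P : Set (Set V)} (hP : IsPolyhedralComplex P)
    (hconv : Convex ℝ (support P)) {Λ Λ' : Set V} (hΛ : Λ ∈ P) (hΛ' : Λ' ∈ P) {v w : V}
    (hv : v ∈ recCone Λ) (hw : w ∈ recCone Λ) (hvw : v + w ∈ recCone Λ') : v ∈ recCone Λ' := by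
  by_contra hcon
  obtain ⟨p, hp⟩ := hP.nonempty_of_mem Λ hΛ
  obtain ⟨q, hq⟩ := hP.nonempty_of_mem Λ' hΛ'
  let S : Set V → Set ℝ := fun E =>
    {s : ℝ | ∃ t₀ : ℝ, ∀ t : ℝ, t₀ ≤ t → (p + s • (q - p)) + t • (v + w) ∈ E}
  -- Both `v` and `w` are tracked, since passing from one polyhedron to another that meets it uses
  -- both memberships.
  let A : Set (Set V) := {E ∈ P | v ∈ recCone E ∧ w ∈ recCone E}
  let B : Set (Set V) := {E ∈ P | ¬(v ∈ recCone E ∧ w ∈ recCone E)}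
  have hclosed : ∀ C ⊆ P, IsClosed (⋃ E ∈ C, S E) := fun C hC =>
    (hP.finite.subset hC).isClosed_biUnion fun E hE =>
      (hP.isPolyhedron E (hC hE)).isClosed_eventually_mem _ _ _
  have hpray : ∀ t : ℝ, 0 ≤ t → p + t • (v + w) ∈ Λ := fun t ht => by
    have := add_smul_mem_of_mem_recCone (add_smul_mem_of_mem_recCone hp hv ht) hw ht
    simpa [add_assoc] using this
  have hqray : ∀ t : ℝ, 0 ≤ t → q + t • (v + w) ∈ Λ' := fun t ht =>
    add_smul_mem_of_mem_recCone hq hvw ht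
  have hcover : Set.Icc (0 : ℝ) 1 ⊆ (⋃ E ∈ A, S E) ∪ ⋃ E ∈ B, S E := by
    intro s hs
    obtain ⟨E, hE, hmem⟩ := hP.exists_eventually_mem (p := p + s • (q - p)) (u := v + w)
      fun t ht => by
        have h1 : p + t • (v + w) ∈ support P := Set.mem_biUnion hΛ (hpray t ht)
        have h2 : q + t • (v + w) ∈ support P := Set.mem_biUnion hΛ' (hqray t ht)
        have := hconv h1 h2 (sub_nonneg.2 hs.2) hs.1 (sub_add_cancel 1 s)
        convert this using 1
        module
    by_cases h : v ∈ recCone E ∧ w ∈ recCone E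
    · exact Or.inl (Set.mem_biUnion (show E ∈ A from ⟨hE, h⟩) hmem)
    · exact Or.inr (Set.mem_biUnion (show E ∈ B from ⟨hE, h⟩) hmem)
  have h0 : (Set.Icc (0 : ℝ) 1 ∩ ⋃ E ∈ A, S E).Nonempty :=
    ⟨0, by simp, Set.mem_biUnion (show Λ ∈ A from ⟨hΛ, hv, hw⟩)
      ⟨0, fun t ht => by simpa using hpray t ht⟩⟩
  have h1 : (Set.Icc (0 : ℝ) 1 ∩ ⋃ E ∈ B, S E).Nonempty :=
    ⟨1, by simp, Set.mem_biUnion (show Λ' ∈ B from ⟨hΛ', fun h => hcon h.1⟩)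
      ⟨0, fun t ht => by simpa using hqray t ht⟩⟩
  obtain ⟨s, -, hsA, hsB⟩ := isPreconnected_closed_iff.1 isPreconnected_Icc _ _
    (hclosed A fun _ h => h.1) (hclosed B fun _ h => h.1) hcover h0 h1
  obtain ⟨E, hE, tE, htE⟩ := Set.mem_iUnion₂.1 hsA
  obtain ⟨F, hF, tF, htF⟩ := Set.mem_iUnion₂.1 hsB
  have hrec : v + w ∈ recCone F := (hP.isPolyhedron F hF.1).mem_recCone htF
  -- At time `max tE tF` the ray is in `E` and in `F`, so these two polyhedra have a common point.
  have hzE := htE _ (le_max_left tE tF)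
  have hzF := htF _ (le_max_right tE tF)
  exact hF.2 ⟨hP.recCone_extreme_of_mem_inter hE.1 hF.1 hzE hzF hE.2.1 hE.2.2 hrec,
    hP.recCone_extreme_of_mem_inter hE.1 hF.1 hzE hzF hE.2.2 hE.2.1 (add_comm v w ▸ hrec)⟩

end KeyLemma

/-! ### The two conic complexes -/

section ConicComplexes

variable {V : Type*} [NormedAddCommGroup V] [NormedSpace ℝ V] [FiniteDimensional ℝ V]

lemma IsPolyhedralComplex.isConicComplex_recComplex {P : Set (Set V)}
    (hP : IsPolyhedralComplex P) (hconv : Convex ℝ (support P)) :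
    IsConicComplex (recComplex P) := by
  refine isConicComplex_of_extreme ?_ ?_ ?_ ?_ ?_
  · obtain ⟨Λ, hΛ⟩ := hP.nonempty
    exact ⟨_, Λ, hΛ, rfl⟩
  · refine (hP.finite.image recCone).subset ?_
    rintro _ ⟨Λ, hΛ, rfl⟩
    exact ⟨Λ, hΛ, rfl⟩
  · rintro _ ⟨Λ, hΛ, rfl⟩
    exact (hP.isPolyhedron Λ hΛ).exists_recCone_eq_dualSet (hP.nonempty_of_mem Λ hΛ)
  · rintro _ ⟨Λ, hΛ, rfl⟩ F hF
    obtain ⟨G, hG, rfl⟩ := exists_face_of_isFace_recCone (hP.isPolyhedron Λ hΛ)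
      (hP.nonempty_of_mem Λ hΛ) hF
    exact ⟨G, hP.face_mem Λ hΛ G hG, rfl⟩
  · rintro _ ⟨Λ, hΛ, rfl⟩ _ ⟨Λ', hΛ', rfl⟩ a ha b hb hab
    exact hP.recCone_extreme hconv hΛ hΛ' ha hb hab

/-- The cone of `Λ ∩ Λ'` is extreme in the cone of `Λ`, at positive heights. -/
lemma IsPolyhedralComplex.coneOf_extreme_of_pos {P : Set (Set V)} (hP : IsPolyhedralComplex P)
    {Λ Λ' : Set V} (hΛ : Λ ∈ P) (hΛ' : Λ' ∈ P) {a b : V × ℝ} (ha : a ∈ coneOf Λ)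
    (hb : b ∈ coneOf Λ) (hab : a + b ∈ coneOf Λ') (hpos : 0 < (a + b).2) : a ∈ coneOf Λ' := by
  have hpΛ := hP.isPolyhedron Λ hΛ
  have hnΛ := hP.nonempty_of_mem Λ hΛ
  have hpΛ' := hP.isPolyhedron Λ' hΛ'
  have hnΛ' := hP.nonempty_of_mem Λ' hΛ'
  have hz : (a + b).2⁻¹ • (a + b).1 ∈ Λ := by
    obtain ⟨X, hX⟩ := hpΛ.exists_coneOf_eq_dualSet hnΛ
    have : a + b ∈ coneOf Λ := by rw [hX] at ha hb ⊢; exact add_mem_dualSet ha hb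
    rcases (mem_coneOf_iff hpΛ hnΛ).1 this with h | h
    exacts [h.2, absurd h.1 hpos.ne']
  have hz' : (a + b).2⁻¹ • (a + b).1 ∈ Λ' := by
    rcases (mem_coneOf_iff hpΛ' hnΛ').1 hab with h | h
    exacts [h.2, absurd h.1 hpos.ne']
  generalize hzdef : (a + b).2⁻¹ • (a + b).1 = z at hz hz'
  obtain ⟨⟨-, x, hx⟩, -⟩ :=
    (hP.inter Λ hΛ Λ' hΛ').resolve_left fun h => Set.disjoint_left.1 h hz hz'
  have hzm : z ∈ minSet Λ x := hx ▸ ⟨hz, hz'⟩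
  -- The form `(v, t) ↦ x v - (x z) t` is nonnegative on the cone of `Λ` and vanishes at `a + b`,
  -- hence at `a`; this places `a` over the common face.
  have hnn : ∀ c ∈ coneOf Λ, x z * c.2 ≤ x c.1 := by
    intro c hc
    rcases (mem_coneOf_iff hpΛ hnΛ).1 hc with ⟨h, hc⟩ | ⟨h, hc⟩
    · have := hzm.2 _ hc
      rwa [map_smul, smul_eq_mul, inv_mul_eq_div, le_div_iff₀ h] at this
    · have := hzm.2 _ (add_smul_mem_of_mem_recCone hz hc zero_le_one)
      rw [map_add, one_smul] at this
      rw [h, mul_zero]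
      linarith
  have hsum : x a.1 + x b.1 = x z * (a.2 + b.2) := by
    rw [← hzdef, map_smul, smul_eq_mul, inv_mul_eq_div, ← Prod.snd_add,
      div_mul_cancel₀ _ hpos.ne', Prod.fst_add, map_add]
  have hxa : x a.1 = x z * a.2 := by linarith [hnn a ha, hnn b hb]
  rw [mem_coneOf_iff hpΛ' hnΛ']
  rcases (mem_coneOf_iff hpΛ hnΛ).1 ha with ⟨h, hc⟩ | ⟨h, hc⟩
  · left
    have hm : a.2⁻¹ • a.1 ∈ minSet Λ x := by
      refine ⟨hc, ?_⟩
      have : x (a.2⁻¹ • a.1) = x z := by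
        rw [map_smul, smul_eq_mul, inv_mul_eq_div, hxa, mul_div_cancel_right₀ _ h.ne']
      rw [this]
      exact hzm.2
    rw [← hx] at hm
    exact ⟨h, hm.2⟩
  · right
    rw [h, mul_zero] at hxa
    refine ⟨h, hpΛ'.mem_recCone (p := z) (t₀ := 0) fun t ht => ?_⟩
    have hm : z + t • a.1 ∈ minSet Λ x :=
      ⟨add_smul_mem_of_mem_recCone hz hc ht, by simpa [hxa] using hzm.2⟩
    rw [← hx] at hm
    exact hm.2

lemma IsPolyhedralComplex.isConicComplex_coneComplex {P : Set (Set V)}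
    (hP : IsPolyhedralComplex P) (hconv : Convex ℝ (support P)) :
    IsConicComplex (coneComplex P) := by
  have hc : ∀ {Λ}, Λ ∈ P → ∀ {w : V × ℝ}, w ∈ coneOf Λ ↔
      (0 < w.2 ∧ w.2⁻¹ • w.1 ∈ Λ) ∨ (w.2 = 0 ∧ w.1 ∈ recCone Λ) := fun hΛ _ =>
    mem_coneOf_iff (hP.isPolyhedron _ hΛ) (hP.nonempty_of_mem _ hΛ)
  have hsnd : ∀ {Λ}, Λ ∈ P → ∀ {w : V × ℝ}, w ∈ coneOf Λ → 0 ≤ w.2 := fun hΛ _ =>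
    snd_nonneg_of_mem_coneOf (hP.isPolyhedron _ hΛ) (hP.nonempty_of_mem _ hΛ)
  have hrec : ∀ {Λ}, Λ ∈ P → ∀ {w : V × ℝ}, w ∈ coneOf Λ → w.2 = 0 → w.1 ∈ recCone Λ :=
    fun hΛ _ hw h0 => ((hc hΛ).1 hw).elim (fun h => absurd h0 h.1.ne') fun h => h.2
  refine isConicComplex_of_extreme ?_ ?_ ?_ ?_ ?_
  · obtain ⟨Λ, hΛ⟩ := hP.nonempty
    exact ⟨_, Or.inl ⟨Λ, hΛ, rfl⟩⟩
  · refine ((hP.finite.image coneOf).union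
      (hP.finite.image fun Λ => recCone Λ ×ˢ {(0 : ℝ)})).subset ?_
    rintro _ (⟨Λ, hΛ, rfl⟩ | ⟨_, ⟨Λ, hΛ, rfl⟩, rfl⟩)
    exacts [Or.inl ⟨Λ, hΛ, rfl⟩, Or.inr ⟨Λ, hΛ, rfl⟩]
  · classical
    rintro _ (⟨Λ, hΛ, rfl⟩ | ⟨_, ⟨Λ, hΛ, rfl⟩, rfl⟩)
    · exact (hP.isPolyhedron Λ hΛ).exists_coneOf_eq_dualSet (hP.nonempty_of_mem Λ hΛ)
    · obtain ⟨X, hX⟩ := (hP.isPolyhedron Λ hΛ).exists_recCone_eq_dualSet (hP.nonempty_of_mem Λ hΛ)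
      exact ⟨_, hX ▸ dualSet_prod_zero X⟩
  · rintro _ (⟨Λ, hΛ, rfl⟩ | ⟨_, ⟨Λ, hΛ, rfl⟩, rfl⟩) F hF
    · obtain ⟨G, hG, rfl | rfl⟩ := exists_face_of_isFace_coneOf (hP.isPolyhedron Λ hΛ)
        (hP.nonempty_of_mem Λ hΛ) (fun G hG => hP.isPolyhedron G (hP.face_mem Λ hΛ G hG)) hF
      · exact Or.inl ⟨G, hP.face_mem Λ hΛ G hG, rfl⟩
      · exact Or.inr ⟨_, ⟨G, hP.face_mem Λ hΛ G hG, rfl⟩, rfl⟩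
    · obtain ⟨K, hK, rfl⟩ := isFace_prod_zero hF
      exact Or.inr ⟨K, (hP.isConicComplex_recComplex hconv).1.face_mem _ ⟨Λ, hΛ, rfl⟩ K hK, rfl⟩
  -- Heights are nonnegative, so a sum of height zero has both terms at height zero and
  -- `recCone_extreme` applies. Positive height occurs only when source and target are both cones
  -- over polyhedra.
  · rintro _ (⟨Λ, hΛ, rfl⟩ | ⟨_, ⟨Λ, hΛ, rfl⟩, rfl⟩) _
      (⟨Λ', hΛ', rfl⟩ | ⟨_, ⟨Λ', hΛ', rfl⟩, rfl⟩) a ha b hb hab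
    · rcases (hsnd hΛ' hab).eq_or_lt with h | h
      · have h := h.symm
        have hab0 : a.2 + b.2 = 0 := h
        have ha0 : a.2 = 0 := by linarith [hsnd hΛ ha, hsnd hΛ hb]
        have hb0 : b.2 = 0 := by linarith
        exact (hc hΛ').2 (Or.inr ⟨ha0, hP.recCone_extreme hconv hΛ hΛ' (hrec hΛ ha ha0)
          (hrec hΛ hb hb0) (hrec hΛ' hab h)⟩)
      · exact hP.coneOf_extreme_of_pos hΛ hΛ' ha hb hab h
    · have hab0 : a.2 + b.2 = 0 := hab.2
      have ha0 : a.2 = 0 := by linarith [hsnd hΛ ha, hsnd hΛ hb]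
      have hb0 : b.2 = 0 := by linarith
      exact ⟨hP.recCone_extreme hconv hΛ hΛ' (hrec hΛ ha ha0) (hrec hΛ hb hb0) hab.1, ha0⟩
    · have ha0 : a.2 = 0 := ha.2
      have hb0 : b.2 = 0 := hb.2
      have hab0 : (a + b).2 = 0 := by rw [Prod.snd_add, ha0, hb0, add_zero]
      exact (hc hΛ').2 (Or.inr ⟨ha0, hP.recCone_extreme hconv hΛ hΛ' ha.1 hb.1
        (hrec hΛ' hab hab0)⟩)
    · exact ⟨hP.recCone_extreme hconv hΛ hΛ' ha.1 hb.1 hab.1, ha.2⟩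

end ConicComplexes

end PolyComplex

theorem corollary3p9 {V : Type*} [NormedAddCommGroup V] [NormedSpace ℝ V] [FiniteDimensional ℝ V]
    (L : Submodule ℤ V) [DiscreteTopology L] [IsZLattice ℝ L]
    (P : Set (Set V)) (hP : PolyComplex.IsPolyhedralComplex P)
    (hconv : Convex ℝ (PolyComplex.support P)) :
    (PolyComplex.IsConicComplex (PolyComplex.recComplex P) ∧
      PolyComplex.IsConicComplex (PolyComplex.coneComplex P)) ∧
    (PolyComplex.IsRational L P →
      PolyComplex.IsRational L (PolyComplex.recComplex P) ∧
        PolyComplex.IsRational (PolyComplex.latticeProdInt L) (PolyComplex.coneComplex P)) ∧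
    (PolyComplex.IsStronglyConvex P →
      PolyComplex.IsFan (PolyComplex.recComplex P) ∧
        PolyComplex.IsFan (PolyComplex.coneComplex P)) := by
  have hrec := hP.isConicComplex_recComplex hconv
  have hcone := hP.isConicComplex_coneComplex hconv
  refine ⟨⟨hrec, hcone⟩, fun h => ⟨?_, ?_⟩, fun h => ⟨⟨hrec, ?_⟩, hcone, ?_⟩⟩
  · rintro _ ⟨Λ, hΛ, rfl⟩
    exact PolyComplex.isRationalPolyhedron_recCone (hP.nonempty_of_mem Λ hΛ) (h Λ hΛ)
  · rintro _ (⟨Λ, hΛ, rfl⟩ | ⟨_, ⟨Λ, hΛ, rfl⟩, rfl⟩)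
    · exact PolyComplex.isRationalPolyhedron_coneOf (hP.nonempty_of_mem Λ hΛ) (h Λ hΛ)
    · exact PolyComplex.isRationalPolyhedron_recCone_prod_zero (hP.nonempty_of_mem Λ hΛ) (h Λ hΛ)
  · rintro _ ⟨Λ, hΛ, rfl⟩
    exact PolyComplex.containsNoLine_recCone (hP.isPolyhedron Λ hΛ) (hP.nonempty_of_mem Λ hΛ)
      (h Λ hΛ)
  · rintro _ (⟨Λ, hΛ, rfl⟩ | ⟨_, ⟨Λ, hΛ, rfl⟩, rfl⟩)
    · exact PolyComplex.containsNoLine_coneOf (hP.isPolyhedron Λ hΛ) (hP.nonempty_of_mem Λ hΛ)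
        (h Λ hΛ)
    · exact PolyComplex.containsNoLine_prod_zero
        (PolyComplex.containsNoLine_recCone (hP.isPolyhedron Λ hΛ) (hP.nonempty_of_mem Λ hΛ)
          (h Λ hΛ))
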